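/- Let $1\le b<n$ be integers and let $\mathcal E\subset\mathbb R^2$ be a measurable environment. Agents $A_1,\dots,A_n$ are disks of radii $r_i>0$ with centers initially at $\mathbf s_i$ and destinations $\mathbf d_i$. Write $B(\mathbf x,r)$ for the closed disk, $\mathcal S=\bigcup_i B(\mathbf s_i,r_i)$, $\mathcal D=\bigcup_i B(\mathbf d_i,r_i)$, $\hat r=\max_i r_i$, $|\cdot|$ for the area, and assume $\mathcal S\cap\mathcal D=\emptyset$. Suppose that there are an operation time $T>0$ and trajectories $\mathbf p_i:[0,T]\to\mathbb R^2$ for the environment without obstacles, with $\mathbf p_i(0)=\mathbf s_i$, $\mathbf p_i(T)=\mathbf d_i$, $B(\mathbf p_i(t),r_i)\subseteq\mathcal E$ for all $t\in[0,T]$, which do not overlap, i.e. $\|\mathbf p_i(t)-\mathbf p_j(t')\|_2\ge r_i+r_j$ for all $i\ne j$ and $t,t'\in[0,T]$. Suppose that they are differentiable with velocities $\mathbf v_i(t)$, and that the maximal speed $\|\hat{\mathbf v}\|_2=\max_{i}\max_{t\in[0,T]}\|\mathbf v_i(t)\|_2$ exists. Let $\Delta\subseteq\mathcal E\setminus(\mathcal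 S\cup\mathcal D)$ be a non-empty measurable initial obstacle region of finite area with $\mathcal E\setminus(\Delta\cup\mathcal S\cup\mathcal D)\neq\emptyset$, let $\rho_1\ge\dots\ge\rho_n>0$ be the priorities of the agents, and let $\dot\Delta$ be a real number (the capacity) with $$2b\,\hat r\,\|\hat{\mathbf v}\|_2\le\dot\Delta<2(b+1)\,\hat r\,\|\hat{\mathbf v}\|_2 .$$ Then, for every integer $H\ge1$, all tasks can be completed online in the following sense. Cut every trajectory into $H$ sub-tasks of duration $T/H$, and time into slices of duration $T/H$. There are a schedule that selects at most $b$ agents in every time slice and selects every agent exactly $H$ times in total, motions $\mathbf q_i:[0,\infty)\to\mathbb R^2$ such that, in each slice, every selected agent carries out its next sub-task along $\mathbf p_i$ and every other agent stands still, and an online obstacle policy that determines the obstacle region $\Delta_t$ at time $t$ from the current positions $\mathbf q_1(t),\dots,\mathbf q_n(t)$, such that: 1. $\Delta_0=\Delta$, and for all $t\ge0$ the set $\Delta_t\subseteq\mathcal E$ is measurable with $|\Delta_t|=|\Delta|$; moreover $\tfrac12\,|(\Delta_{t_1}\cup\Delta_{t_2})\setminus(\Delta_{t_1}\cap\Delta_{t_2})|\le\dot\Delta\,(t_2-t_1)$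 for all $0\le t_1\le t_2$; 2. there is no collision: for all $t\ge0$, $B(\mathbf q_i(t),r_i)\subseteq\mathcal E$, every point of $\Delta_t$ has distance at least $r_i$ from $\mathbf q_i(t)$, and $\|\mathbf q_i(t)-\mathbf q_j(t)\|_2\ge r_i+r_j$ for $i\ne j$; 3. every task is completed: $\mathbf q_i(0)=\mathbf s_i$, and there is a time $T_i\ge0$ with $\mathbf q_i(t)=\mathbf d_i$ for all $t\ge T_i$ and $$T_i\le\frac{C_T}{\rho_i},\qquad i=1,\dots,n,$$ with the constant, determined by $b$ (and by $\rho_1,\dots,\rho_n$ and $T$), $$C_T=\max_{1\le i\le n}\ \frac{2\,i\,T}{\sum_{k=1}^{i}\min\{i+1-k,\,b\}\left(\frac1{\rho_k}-\frac1{\rho_{k-1}}\right)},\qquad \frac1{\rho_0}:=0 .$$ -/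

import Mathlib

open Set MeasureTheory

noncomputable section

namespace EnvOpt

/-- The plane, with its Euclidean norm. -/
abbrev Plane : Type := EuclideanSpace ℝ (Fin 2)

/-- The region occupied by `n` agents: the union of the closed disks of radii `r i` about the
positions `x i`. With `x` the initial positions this is the starting region, with `x` the
destinations it is the destination region. -/
def occupied {n : ℕ} (r : Fin n → ℝ) (x : Fin n → Plane) : Set Plane :=
  ⋃ i, Metric.closedBall (x i) (r i)

/-- In the environment `E` without obstacles, the trajectories `p i`, of operation time `T`, lead
every agent from its initial position to its destination inside `E`, and they do not overlap:
the body of an agent anywhere on its trajectory does not overlap the body of another agent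
anywhere on its own trajectory (touching is not a collision). -/
structure IsEmptyEnvironmentPlan {n : ℕ} (E : Set Plane) (r : Fin n → ℝ) (s d : Fin n → Plane)
    (T : ℝ) (p : Fin n → ℝ → Plane) : Prop where
  start_eq : ∀ i, p i 0 = s i
  end_eq : ∀ i, p i T = d i
  mem_env : ∀ i, ∀ t ∈ Icc 0 T, Metric.closedBall (p i t) (r i) ⊆ E
  nonoverlap : ∀ i j, i ≠ j → ∀ t ∈ Icc 0 T, ∀ t' ∈ Icc 0 T, r i + r j ≤ ‖p i t - p j t'‖

/-- The moving obstacle region `O` starts at `Δ`, stays inside the environment `E`, keeps its area,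
and its area changes at rate at most `c`: half of the area of the symmetric difference of the
regions at times `t₁ ≤ t₂` is at most `c * (t₂ - t₁)`. -/
structure IsObstacleMotion (E Δ : Set Plane) (c : ℝ) (O : ℝ → Set Plane) : Prop where
  init : O 0 = Δ
  measurable : ∀ t, 0 ≤ t → MeasurableSet (O t)
  subset_env : ∀ t, 0 ≤ t → O t ⊆ E
  area_eq : ∀ t, 0 ≤ t → volume (O t) = volume Δ
  rate_le : ∀ t₁ t₂, 0 ≤ t₁ → t₁ ≤ t₂ →
    volume (symmDiff (O t₁) (O t₂)) / 2 ≤ ENNReal.ofReal (c * (t₂ - t₁))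

/-- Navigation without collision: at every time, every agent is inside the environment, its center
has distance at least its radius from the obstacle region of that time, and the centers of any two
agents have distance at least the sum of the radii. `q t i` is the position of agent `i` at
time `t`. -/
structure IsCollisionFree {n : ℕ} (E : Set Plane) (r : Fin n → ℝ) (O : ℝ → Set Plane)
    (q : ℝ → Fin n → Plane) : Prop where
  mem_env : ∀ t, 0 ≤ t → ∀ i, Metric.closedBall (q t i) (r i) ⊆ E
  obstacle : ∀ t, 0 ≤ t → ∀ i, ∀ z ∈ O t, r i ≤ ‖q t i - z‖
  agents : ∀ t, 0 ≤ t → ∀ i j, i ≠ j → r i + r j ≤ ‖q t i - q t j‖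

/-- How often agent `i` has been served in the time slices `0, …, k - 1`, where `σ l` is the set
of agents that are served in the time slice `l`. -/
def servedCount {n : ℕ} (σ : ℕ → Finset (Fin n)) (i : Fin n) (k : ℕ) : ℕ :=
  ((Finset.range k).filter (fun l => i ∈ σ l)).card

/-- The trajectories `p i` on `[0, T]` are cut into `H` sub-tasks of duration `T / H`, and time is
cut into slices of duration `T / H`. In a time slice, a served agent carries out its next
sub-task and all other agents stand still. -/
def FollowsSchedule {n : ℕ} (T : ℝ) (H : ℕ) (p : Fin n → ℝ → Plane) (σ : ℕ → Finset (Fin n))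
    (q : ℝ → Fin n → Plane) : Prop :=
  ∀ (k : ℕ) (t : ℝ), (k : ℝ) * (T / H) ≤ t → t ≤ ((k : ℝ) + 1) * (T / H) → ∀ i : Fin n,
    (i ∈ σ k → q t i = p i ((servedCount σ i k : ℝ) * (T / H) + (t - (k : ℝ) * (T / H)))) ∧
    (i ∉ σ k → q t i = p i ((servedCount σ i k : ℝ) * (T / H)))

/-- `1 / ρ k - 1 / ρ (k - 1)`, where `1 / ρ (-1)` is read as `0` (agents are indexed from `0`). -/
def invPriorityGap {n : ℕ} (ρ : Fin n → ℝ) (k : Fin n) : ℝ :=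
  1 / ρ k - if 0 < (k : ℕ) then 1 / ρ ⟨(k : ℕ) - 1, lt_of_le_of_lt (Nat.sub_le _ _) k.isLt⟩ else 0

/-- The time constant determined by `b` (and by the priorities and the operation time `T`): the
least `C` such that, with deadlines `C / ρ k`, for every `i` the first `i + 1` agents can get total
service `2 * (i + 1) * T` when at most `b` agents are served at a time. Between the deadlines of
the agents `k - 1` and `k`, there are `i - k + 1` of the first `i + 1` agents left. -/
def timeConstant {n : ℕ} (b : ℕ) (ρ : Fin n → ℝ) (T : ℝ) : ℝ :=
  ⨆ i : Fin n, 2 * ((i : ℝ) + 1) * T /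
    ∑ k ∈ Finset.Iic i, ((min ((i : ℕ) - (k : ℕ) + 1) b : ℕ) : ℝ) * invPriorityGap ρ k

end EnvOpt

end

namespace EnvOpt

/-! Agents run in index order in batches of `b`, each batch for time `T`. The plans avoid one
another at any pair of times, so the order cannot cause a collision between agents. The obstacle
yields to the bodies: from `Δ` remove the open disks at the current positions, and compensate with
the vacated part of the starting disks left of a vertical line, placed so that the area is again
that of `Δ`. A suitable line exists by the intermediate value theorem
(`exists_volume_sweptRegion_eq`), since the starting disks do not overlap and so have at least the
area of the disks anywhere else.

Regions of equal area differ, on each side, by at most what the bodies newly cover or newly uncover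
(`volume_symmDiff_sweptRegion_le`). A disk of radius `r` moved by `δ` gains area at most `2 * r *
δ`, and at most `b` agents move at once, so the rate is at most `2 * b * rmax * vmax`. The deadlines
are a counting estimate (`batch_completion_le`). -/

/-! ### Area gained by a translated disk -/

lemma measurableSet_axis_lune (δ r : ℝ) : MeasurableSet
    {z : ℝ × ℝ | (z.1 - δ) ^ 2 + z.2 ^ 2 < r ^ 2 ∧ r ^ 2 ≤ z.1 ^ 2 + z.2 ^ 2} := by
  have h1 : MeasurableSet {z : ℝ × ℝ | (z.1 - δ) ^ 2 + z.2 ^ 2 < r ^ 2} :=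
    measurableSet_lt (by fun_prop) (by fun_prop)
  have h2 : MeasurableSet {z : ℝ × ℝ | r ^ 2 ≤ z.1 ^ 2 + z.2 ^ 2} :=
    measurableSet_le (by fun_prop) (by fun_prop)
  exact h1.inter h2

/-- The region by which a planar disk grows under a translation along the first axis. -/
lemma volume_axis_lune_le {δ r : ℝ} (hδ : 0 ≤ δ) (hr : 0 ≤ r) :
    volume {z : ℝ × ℝ | (z.1 - δ) ^ 2 + z.2 ^ 2 < r ^ 2 ∧ r ^ 2 ≤ z.1 ^ 2 + z.2 ^ 2}
      ≤ ENNReal.ofReal (2 * r * δ) := by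
  have hm := measurableSet_axis_lune δ r
  rw [Measure.volume_eq_prod, Measure.prod_apply_symm hm]
  calc _ ≤ ∫⁻ w : ℝ, (Icc (-r) r).indicator (fun _ => ENNReal.ofReal δ) w := by
        refine lintegral_mono fun w => ?_
        by_cases hw : w ∈ Icc (-r) r
        · rw [indicator_of_mem hw]
          have hw2 : 0 ≤ r ^ 2 - w ^ 2 := by nlinarith [hw.1, hw.2]
          -- At height `w` both disks cut chords of the same half-length, shifted by `δ`; the gain
          -- lies in an interval of length `δ` at the right end.
          refine (measure_mono (t := Ico √(r ^ 2 - w ^ 2) (√(r ^ 2 - w ^ 2) + δ)) ?_).trans ?_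
          · rintro u ⟨h1, h2⟩
            simp only at h1 h2
            have hs := Real.sqrt_nonneg (r ^ 2 - w ^ 2)
            have h3 : |u - δ| < √(r ^ 2 - w ^ 2) := by
              apply Real.lt_sqrt_of_sq_lt
              rw [sq_abs]
              linarith
            have h4 : √(r ^ 2 - w ^ 2) ≤ |u| := by
              apply Real.sqrt_le_iff.2 ⟨abs_nonneg _, ?_⟩
              rw [sq_abs]
              linarith
            obtain ⟨h5, h6⟩ := abs_lt.1 h3
            refine ⟨?_, by linarith⟩
            rcases le_abs.1 h4 with h | h <;> linarith
          · rw [Real.volume_Ico]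
            simp
        · rw [indicator_of_notMem hw]
          refine le_of_eq (measure_mono_null (t := ∅) ?_ measure_empty)
          rintro u ⟨h1, -⟩
          simp only at h1
          exact hw (abs_le.1 (abs_le_of_sq_le_sq (by nlinarith [sq_nonneg (u - δ)]) hr))
    _ = ENNReal.ofReal (2 * r * δ) := by
        rw [lintegral_indicator measurableSet_Icc, setLIntegral_const, Real.volume_Icc,
          ← ENNReal.ofReal_mul hδ]
        congr 1
        ring

/-- The area that a disk gains by a translation. -/
lemma volume_ball_diff_ball_le (x y : Plane) {r : ℝ} (hr : 0 ≤ r) :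
    volume (Metric.ball y r \ Metric.ball x r) ≤ ENNReal.ofReal (2 * r * ‖y - x‖) := by
  rcases eq_or_ne y x with rfl | hxy
  · simp
  have hδ : ‖y - x‖ ≠ 0 := norm_ne_zero_iff.2 (sub_ne_zero.2 hxy)
  -- Coordinates centred at `x` with first axis along `y - x` reduce to the axis case.
  obtain ⟨e, he⟩ := Orthonormal.exists_orthonormalBasis_extension_of_card_eq (𝕜 := ℝ) (E := Plane)
    (ι := Fin 2) (by simp) (v := fun _ => ‖y - x‖⁻¹ • (y - x)) (s := {0}) (by
      refine ⟨fun i => ?_, fun i j hij => (hij (Subsingleton.elim i j)).elim⟩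
      simp [norm_smul, hδ])
  have he0 : y - x = ‖y - x‖ • e 0 := by
    rw [he 0 rfl, smul_smul, mul_inv_cancel₀ hδ, one_smul]
  have hrepr : e.repr (y - x) = ‖y - x‖ • EuclideanSpace.single 0 (1 : ℝ) := by
    conv_lhs => rw [he0]
    rw [map_smul, e.repr_self]
  have hφ := (volume_preserving_finTwoArrow ℝ).comp ((PiLp.volume_preserving_ofLp (Fin 2)).comp
    (e.measurePreserving_repr.comp (measurePreserving_sub_right volume x)))
  have hm := measurableSet_axis_lune ‖y - x‖ r
  refine le_trans (le_of_eq ?_) (volume_axis_lune_le (norm_nonneg (y - x)) hr)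
  rw [← hφ.measure_preimage hm.nullMeasurableSet]
  congr 1
  ext z
  have h1 : ‖z - x‖ ^ 2 = e.repr (z - x) 0 ^ 2 + e.repr (z - x) 1 ^ 2 := by
    rw [← e.repr.norm_map, EuclideanSpace.real_norm_sq_eq, Fin.sum_univ_two]
  have h2 : ‖z - y‖ ^ 2 = (e.repr (z - x) 0 - ‖y - x‖) ^ 2 + e.repr (z - x) 1 ^ 2 := by
    rw [← e.repr.norm_map, EuclideanSpace.real_norm_sq_eq, Fin.sum_univ_two,
      show z - y = (z - x) - (y - x) by abel, map_sub, hrepr]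
    simp
  simp only [mem_sdiff, Metric.mem_ball, dist_eq_norm, not_lt, mem_preimage, Function.comp_apply,
    MeasurableEquiv.finTwoArrow_apply, mem_ofPred_eq]
  rw [← sq_lt_sq₀ (norm_nonneg (z - y)) hr, ← sq_le_sq₀ hr (norm_nonneg (z - x)), h1, h2]

/-! ### Swept regions of prescribed area -/

lemma volume_slab_le (a a' R : ℝ) :
    volume {z : Plane | z 0 ∈ Ioc a a' ∧ z 1 ∈ Icc (-R) R} ≤
      ENNReal.ofReal (a' - a) * ENNReal.ofReal (2 * R) := by
  have h : {z : Plane | z 0 ∈ Ioc a a' ∧ z 1 ∈ Icc (-R) R} =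
      WithLp.ofLp ⁻¹' (Set.pi univ ![Ioc a a', Icc (-R) R]) := by
    ext z
    simp [Set.mem_pi, Fin.forall_fin_two]
  have hm : MeasurableSet (Set.pi univ ![Ioc a a', Icc (-R) R]) :=
    MeasurableSet.univ_pi fun i => by
      fin_cases i
      · exact measurableSet_Ioc
      · exact measurableSet_Icc
  rw [h, (PiLp.volume_preserving_ofLp (Fin 2)).measure_preimage hm.nullMeasurableSet,
    volume_pi_pi, Fin.prod_univ_two]
  simp only [Matrix.cons_val_zero, Matrix.cons_val_one, Real.volume_Ioc, Real.volume_Icc]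
  rw [show R - -R = 2 * R by ring]

/-- A region `Δ` that is filled up with the parts of `S` left of a vertical line, less `B`. -/
def sweptRegion (Δ S B : Set Plane) (a : ℝ) : Set Plane :=
  (Δ ∪ (S ∩ {z | z 0 ≤ a})) \ B

lemma measurableSet_sweptRegion {Δ S B : Set Plane} (hΔ : MeasurableSet Δ) (hS : MeasurableSet S)
    (hB : MeasurableSet B) (a : ℝ) : MeasurableSet (sweptRegion Δ S B a) :=
  (hΔ.union (hS.inter (measurableSet_le (by fun_prop) (by fun_prop)))).diff hB

/-- Moving the line adds at most a slab of height `2 * R`, so the area is Lipschitz in `a` and the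
intermediate value theorem applies. -/
lemma exists_volume_sweptRegion_eq {Δ S B : Set Plane} (hΔfin : volume Δ ≠ ⊤)
    (hS : MeasurableSet S) (hSb : Bornology.IsBounded S) (hdisj : Disjoint Δ S)
    (hBS : volume B ≤ volume S) :
    ∃ a, volume (sweptRegion Δ S B a) = volume Δ := by
  obtain ⟨R, hR0, hR⟩ := hSb.exists_pos_norm_le
  have hSfin : volume S ≠ ⊤ := hSb.measure_lt_top.ne
  have hfin : ∀ a, volume (sweptRegion Δ S B a) ≠ ⊤ := fun a =>
    ((measure_mono (sdiff_subset.trans (union_subset_union_right Δ inter_subset_left))).trans_lt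
      ((measure_union_le Δ S).trans_lt (ENNReal.add_lt_top.2 ⟨hΔfin.lt_top, hSfin.lt_top⟩))).ne
  have hcoord : ∀ z ∈ S, ∀ i, |z i| ≤ R := fun z hz i =>
    (PiLp.norm_apply_le z i).trans (hR z hz)
  have hinc : ∀ a a', a ≤ a' → volume.real (sweptRegion Δ S B a) ≤
        volume.real (sweptRegion Δ S B a') ∧ volume.real (sweptRegion Δ S B a') ≤
      volume.real (sweptRegion Δ S B a) + 2 * R * (a' - a) := by
    intro a a' h
    constructor
    · refine measureReal_mono ?_ (hfin a')
      exact sdiff_subset_sdiff_left (union_subset_union_right _ (inter_subset_inter_right _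
        fun z (hz : z 0 ≤ a) => hz.trans h))
    · have hsub : sweptRegion Δ S B a' ⊆ sweptRegion Δ S B a ∪
          {z : Plane | z 0 ∈ Ioc a a' ∧ z 1 ∈ Icc (-R) R} := by
        rintro z ⟨hz | ⟨hz, hza⟩, hzB⟩
        · exact Or.inl ⟨Or.inl hz, hzB⟩
        · rcases le_or_gt (z 0) a with h' | h'
          · exact Or.inl ⟨Or.inr ⟨hz, h'⟩, hzB⟩
          · exact Or.inr ⟨⟨h', hza⟩, abs_le.1 (hcoord z hz 1)⟩
      have hslab := volume_slab_le a a' R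
      rw [← ENNReal.ofReal_mul (by linarith)] at hslab
      have hslab' : volume.real {z : Plane | z 0 ∈ Ioc a a' ∧ z 1 ∈ Icc (-R) R} ≤
          (a' - a) * (2 * R) :=
        ENNReal.toReal_le_of_le_ofReal (mul_nonneg (by linarith) (by linarith)) hslab
      calc _ ≤ volume.real (sweptRegion Δ S B a ∪
            {z : Plane | z 0 ∈ Ioc a a' ∧ z 1 ∈ Icc (-R) R}) :=
            measureReal_mono hsub ((measure_union_le _ _).trans_lt (ENNReal.add_lt_top.2
              ⟨(hfin a).lt_top, hslab.trans_lt ENNReal.ofReal_lt_top⟩)).ne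
        _ ≤ _ := measureReal_union_le _ _
        _ ≤ _ := by linarith
  have hcont : Continuous fun a => volume.real (sweptRegion Δ S B a) := by
    refine (LipschitzWith.of_dist_le_mul (K := ⟨2 * R, by positivity⟩) fun a a' => ?_).continuous
    change _ ≤ 2 * R * _
    rw [Real.dist_eq, Real.dist_eq]
    rcases le_total a a' with h | h
    · rw [abs_sub_comm, abs_sub_comm a, abs_of_nonneg (sub_nonneg.2 h),
        abs_of_nonneg (sub_nonneg.2 (hinc a a' h).1)]
      linarith [(hinc a a' h).2]
    · rw [abs_of_nonneg (sub_nonneg.2 h), abs_of_nonneg (sub_nonneg.2 (hinc a' a h).1)]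
      linarith [(hinc a' a h).2]
  -- The extra `-1` puts the line strictly left of `S`, so nothing of `S` is added.
  have hlow : volume.real (sweptRegion Δ S B (-R - 1)) ≤ volume.real Δ := by
    refine measureReal_mono ?_ hΔfin
    rintro z ⟨hz | ⟨hz, hza⟩, -⟩
    · exact hz
    · have := (abs_le.1 (hcoord z hz 0)).1
      simp only [mem_ofPred_eq] at hza
      linarith
  -- Now all of `S` is added and only `B` is lost, whose area is at most that of `S`.
  have hhigh : volume.real Δ ≤ volume.real (sweptRegion Δ S B R) := by
    refine ENNReal.toReal_mono (hfin R) ?_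
    have h1 : Δ ∪ S ⊆ sweptRegion Δ S B R ∪ B := by
      intro z hz
      by_cases hzB : z ∈ B
      · exact Or.inr hzB
      · refine Or.inl ⟨hz.imp_right fun h => ⟨h, (le_abs_self _).trans (hcoord z h 0)⟩, hzB⟩
    have h2 : volume Δ + volume S ≤ volume (sweptRegion Δ S B R) + volume S := by
      rw [← measure_union hdisj hS]
      exact (measure_mono h1).trans ((measure_union_le _ _).trans (by gcongr))
    exact (ENNReal.add_le_add_iff_right hSfin).1 h2
  obtain ⟨a, ha⟩ := mem_range_of_exists_le_of_exists_ge hcont ⟨_, hlow⟩ ⟨_, hhigh⟩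
  exact ⟨a, (ENNReal.toReal_eq_toReal_iff' (hfin a) hΔfin).1 ha⟩

/-- Swept regions of equal area differ at most by what is newly covered or newly uncovered. -/
lemma volume_symmDiff_sweptRegion_le {Δ S B B' : Set Plane} (hΔ : MeasurableSet Δ)
    (hS : MeasurableSet S) (hB : MeasurableSet B) (hB' : MeasurableSet B') {a a' : ℝ}
    (hfin : volume (sweptRegion Δ S B a) ≠ ⊤)
    (heq : volume (sweptRegion Δ S B a) = volume (sweptRegion Δ S B' a')) {ε : ENNReal}
    (h : volume (B \ B') ≤ ε) (h' : volume (B' \ B) ≤ ε) :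
    volume (symmDiff (sweptRegion Δ S B a) (sweptRegion Δ S B' a')) / 2 ≤ ε := by
  have hO := measurableSet_sweptRegion hΔ hS hB a
  have hO' := measurableSet_sweptRegion hΔ hS hB' a'
  -- Equal areas make the two one-sided differences equal, so only the easier one needs a bound.
  have hdiff : volume (sweptRegion Δ S B a \ sweptRegion Δ S B' a') =
      volume (sweptRegion Δ S B' a' \ sweptRegion Δ S B a) := by
    have e1 := measure_inter_add_sdiff (μ := volume) (sweptRegion Δ S B a) hO'
    have e2 := measure_inter_add_sdiff (μ := volume) (sweptRegion Δ S B' a') hO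
    rw [inter_comm, ← heq, ← e1] at e2
    exact ((ENNReal.add_right_inj ((measure_mono inter_subset_left).trans_lt hfin.lt_top).ne).1
      e2).symm
  -- A line moving right only adds points, so any point lost must be newly covered.
  have hsub : ∀ {B B' : Set Plane} {a a' : ℝ}, a ≤ a' →
      sweptRegion Δ S B a \ sweptRegion Δ S B' a' ⊆ B' \ B := by
    rintro B B' a a' haa' z ⟨⟨hz, hzB⟩, hz'⟩
    refine ⟨by_contra fun hzB' => hz' ⟨?_, hzB'⟩, hzB⟩
    exact hz.imp_right fun hz => ⟨hz.1, le_trans hz.2 haa'⟩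
  have hle : volume (sweptRegion Δ S B a \ sweptRegion Δ S B' a') ≤ ε := by
    rcases le_total a a' with haa' | haa'
    · exact (measure_mono (hsub haa')).trans h'
    · rw [hdiff]
      exact (measure_mono (hsub haa')).trans h
  rw [measure_symmDiff_eq hO.nullMeasurableSet hO'.nullMeasurableSet, ← hdiff, ← two_mul,
    mul_comm, ENNReal.mul_div_cancel_right (by simp) (by simp)]
  exact hle

/-! ### Areas of the union of the bodies -/

/-- The region occupied by the interiors of the bodies of the agents. -/
def openBodies {n : ℕ} (r : Fin n → ℝ) (x : Fin n → Plane) : Set Plane :=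
  ⋃ i, Metric.ball (x i) (r i)

lemma measurableSet_openBodies {n : ℕ} (r : Fin n → ℝ) (x : Fin n → Plane) :
    MeasurableSet (openBodies r x) :=
  MeasurableSet.iUnion fun _ => Metric.isOpen_ball.measurableSet

lemma openBodies_subset_occupied {n : ℕ} (r : Fin n → ℝ) (x : Fin n → Plane) :
    openBodies r x ⊆ occupied r x :=
  iUnion_mono fun _ => Metric.ball_subset_closedBall

lemma isBounded_openBodies {n : ℕ} (r : Fin n → ℝ) (x : Fin n → Plane) :
    Bornology.IsBounded (openBodies r x) :=
  (Bornology.isBounded_iUnion).2 fun _ => Metric.isBounded_ball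

/-- Bodies that do not overlap occupy at least as much area as the same bodies elsewhere. -/
lemma volume_openBodies_le {n : ℕ} {r : Fin n → ℝ} {s : Fin n → Plane}
    (hs : ∀ i j, i ≠ j → r i + r j ≤ ‖s i - s j‖) (x : Fin n → Plane) :
    volume (openBodies r x) ≤ volume (openBodies r s) := by
  have hdisj : Pairwise (Function.onFun Disjoint fun i => Metric.ball (s i) (r i)) := fun i j hij =>
    Metric.ball_disjoint_ball (by rw [dist_eq_norm]; exact hs i j hij)
  rw [openBodies, openBodies, measure_iUnion hdisj fun _ => Metric.isOpen_ball.measurableSet]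
  refine (measure_iUnion_le _).trans (le_of_eq ?_)
  congr 1
  ext i
  rw [Measure.addHaar_ball_center, Measure.addHaar_ball_center volume (s i)]

lemma volume_openBodies_diff_le {n : ℕ} {r : Fin n → ℝ} (hr : ∀ i, 0 ≤ r i) {rmax : ℝ}
    (hrmax : ∀ i, r i ≤ rmax) (x y : Fin n → Plane) :
    volume (openBodies r y \ openBodies r x) ≤
      ENNReal.ofReal (2 * rmax * ∑ i, ‖y i - x i‖) := by
  have hsub : openBodies r y \ openBodies r x ⊆
      ⋃ i, Metric.ball (y i) (r i) \ Metric.ball (x i) (r i) := by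
    rintro z ⟨hz, hz'⟩
    obtain ⟨i, hi⟩ := mem_iUnion.1 hz
    exact mem_iUnion.2 ⟨i, hi, fun h => hz' (mem_iUnion.2 ⟨i, h⟩)⟩
  have hrmax' : ∀ i, 0 ≤ rmax := fun i => (hr i).trans (hrmax i)
  calc _ ≤ _ := measure_mono hsub
    _ ≤ ∑ i, volume (Metric.ball (y i) (r i) \ Metric.ball (x i) (r i)) :=
        measure_iUnion_fintype_le _ _
    _ ≤ ∑ i, ENNReal.ofReal (2 * rmax * ‖y i - x i‖) := Finset.sum_le_sum fun i _ =>
        (volume_ball_diff_ball_le _ _ (hr i)).trans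
          (ENNReal.ofReal_le_ofReal (by gcongr; exact hrmax i))
    _ = _ := by
        rw [← ENNReal.ofReal_sum_of_nonneg fun i _ =>
          mul_nonneg (mul_nonneg zero_le_two (hrmax' i)) (norm_nonneg _), Finset.mul_sum]

end EnvOpt

/-! ### The batch schedule -/

namespace EnvOpt

/-- The schedule that serves the agents in batches of `b`, in the order of their indices, each
batch for `H` consecutive time slices. -/
def batchSchedule (n b H : ℕ) (k : ℕ) : Finset (Fin n) :=
  {i | (i : ℕ) / b = k / H}

lemma card_filter_div_eq_le (n j : ℕ) {b : ℕ} (hb : 1 ≤ b) :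
    (Finset.univ.filter fun i : Fin n => (i : ℕ) / b = j).card ≤ b := by
  calc _ ≤ (Finset.Ico (j * b) (j * b + b)).card := by
        refine Finset.card_le_card_of_injOn (fun i => (i : ℕ)) ?_ Fin.val_injective.injOn
        intro i hi
        have hi' : (i : ℕ) / b = j := by simpa using hi
        simp only [Finset.coe_Ico, mem_Ico]
        rw [← hi']
        exact ⟨Nat.div_mul_le_self _ _, Nat.lt_div_mul_add (by omega)⟩
    _ = b := by simp

/-- Truncated subtraction gives `0` before the batch starts. -/
lemma servedCount_batchSchedule {n b H : ℕ} (hH : 1 ≤ H) (i : Fin n) (k : ℕ) :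
    servedCount (batchSchedule n b H) i k = min H (k - (i : ℕ) / b * H) := by
  have h : (Finset.range k).filter (fun l => i ∈ batchSchedule n b H l) =
      Finset.Ico ((i : ℕ) / b * H) (min k ((i : ℕ) / b * H + H)) := by
    ext l
    simp only [batchSchedule, Finset.mem_filter, Finset.mem_range, Finset.mem_univ, true_and,
      Finset.mem_Ico, lt_min_iff]
    rw [eq_comm, Nat.div_eq_iff (by omega)]
    omega
  rw [servedCount, h, Nat.card_Ico]
  omega

/-- The time for which a batch has been served at time `t`. -/
def batchProgress (T : ℝ) (j : ℕ) (t : ℝ) : ℝ :=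
  min T (max 0 (t - j * T))

lemma batchProgress_mem {T : ℝ} (hT : 0 ≤ T) (j : ℕ) (t : ℝ) : batchProgress T j t ∈ Icc 0 T :=
  ⟨le_min hT (le_max_left _ _), min_le_left _ _⟩

lemma batchProgress_mono (T : ℝ) (j : ℕ) : Monotone (batchProgress T j) := fun _ _ h =>
  min_le_min_left _ (max_le_max_left _ (sub_le_sub_right h _))

/-- Batches run back to back, so their progress adds up to the clock, capped at the end of the last
one. -/
lemma sum_batchProgress {T : ℝ} (hT : 0 ≤ T) (t : ℝ) (m : ℕ) :
    ∑ j ∈ Finset.range m, batchProgress T j t = min (m * T) (max 0 t) := by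
  induction m with
  | zero => simp
  | succ m ih =>
    rw [Finset.sum_range_succ, ih, batchProgress]
    have hm : 0 ≤ (m : ℝ) * T := by positivity
    push_cast
    rw [add_mul, one_mul]
    grind

lemma sum_batchProgress_sub_le {n b : ℕ} (hb : 1 ≤ b) {T : ℝ} (hT : 0 ≤ T) {t₁ t₂ : ℝ}
    (h0 : 0 ≤ t₁) (h : t₁ ≤ t₂) :
    ∑ i : Fin n, (batchProgress T ((i : ℕ) / b) t₂ - batchProgress T ((i : ℕ) / b) t₁) ≤
      b * (t₂ - t₁) := by
  -- Group by batch: each has at most `b` members, and the total progress of distinct batches grows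
  -- at most like the clock.
  rw [← Finset.sum_fiberwise_of_maps_to (t := Finset.range n) (g := fun i : Fin n => (i : ℕ) / b)
    fun i _ => Finset.mem_range.2 ((Nat.div_le_self _ _).trans_lt i.isLt)]
  calc _ ≤ ∑ j ∈ Finset.range n, (b : ℝ) * (batchProgress T j t₂ - batchProgress T j t₁) := by
        refine Finset.sum_le_sum fun j _ => ?_
        rw [Finset.sum_congr rfl (g := fun _ => batchProgress T j t₂ - batchProgress T j t₁)
          fun i hi => by rw [(Finset.mem_filter.1 hi).2], Finset.sum_const, nsmul_eq_mul]
        exact mul_le_mul_of_nonneg_right (by exact_mod_cast card_filter_div_eq_le n j hb)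
          (sub_nonneg.2 (batchProgress_mono T j h))
    _ = b * (min (n * T) (max 0 t₂) - min (n * T) (max 0 t₁)) := by
        rw [← Finset.mul_sum, Finset.sum_sub_distrib, sum_batchProgress hT, sum_batchProgress hT]
    _ ≤ b * (t₂ - t₁) := by
        refine mul_le_mul_of_nonneg_left ?_ (Nat.cast_nonneg b)
        grind

lemma followsSchedule_batchSchedule {n b H : ℕ} (hH : 1 ≤ H) {T : ℝ} (hT : 0 ≤ T)
    (p : Fin n → ℝ → Plane) :
    FollowsSchedule T H p (batchSchedule n b H)
      (fun t i => p i (batchProgress T ((i : ℕ) / b) t)) := by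
  intro k t hkt htk i
  have hH0 : (0 : ℝ) < H := by exact_mod_cast hH
  obtain ⟨τ, hτ⟩ : ∃ τ, τ = T / H := ⟨_, rfl⟩
  have hτ0 : 0 ≤ τ := by rw [hτ]; positivity
  have hTτ : T = H * τ := by rw [hτ]; field_simp
  rw [← hτ] at hkt htk ⊢
  rw [servedCount_batchSchedule hH]
  obtain ⟨j, hj⟩ : ∃ j, j = (i : ℕ) / b := ⟨_, rfl⟩
  have hmem : i ∈ batchSchedule n b H k ↔ j * H ≤ k ∧ k < j * H + H := by
    simp only [batchSchedule, Finset.mem_filter, Finset.mem_univ, true_and, ← hj]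
    rw [eq_comm, Nat.div_eq_iff (by omega)]
    omega
  simp only [hmem, ← hj]
  refine ⟨fun ⟨h1, h2⟩ => ?_, fun hk => ?_⟩
  · obtain ⟨m, rfl⟩ := Nat.exists_eq_add_of_le h1
    have hm : m + 1 ≤ H := by omega
    have hm' : ((m : ℝ) + 1) * τ ≤ H * τ :=
      mul_le_mul_of_nonneg_right (by exact_mod_cast hm) hτ0
    have hm0 : 0 ≤ (m : ℝ) * τ := by positivity
    rw [show min H (j * H + m - j * H) = m by omega]
    push_cast at hkt htk ⊢
    congr 1
    rw [batchProgress, hTτ, max_eq_right (by linarith), min_eq_right (by linarith)]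
    ring
  -- An idle agent waits at `p i 0` before its batch or at `p i T` after it.
  · rcases Nat.lt_or_ge k (j * H) with h1 | h1
    · have h2 : ((k : ℝ) + 1) * τ ≤ (j * H) * τ :=
        mul_le_mul_of_nonneg_right (by exact_mod_cast h1) hτ0
      rw [show min H (k - j * H) = 0 by omega]
      congr 1
      rw [batchProgress, max_eq_left (by rw [hTτ]; linarith), min_eq_right hT]
      simp
    · have h2 : j * H + H ≤ k := by omega
      have h3 : ((j : ℝ) * H + H) * τ ≤ k * τ :=
        mul_le_mul_of_nonneg_right (by exact_mod_cast h2) hτ0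
      rw [show min H (k - j * H) = H by omega]
      congr 1
      rw [batchProgress, hTτ]
      exact min_eq_left (le_max_of_le_right (by linarith))

/-! ### Deadlines -/

lemma invPriorityGap_nonneg {n : ℕ} {ρ : Fin n → ℝ} (hρpos : ∀ i, 0 < ρ i) (hρ : Antitone ρ)
    (k : Fin n) : 0 ≤ invPriorityGap ρ k := by
  rw [invPriorityGap, sub_nonneg]
  split_ifs
  · exact one_div_le_one_div_of_le (hρpos k) (hρ (Fin.le_def.2 (Nat.sub_le _ _)))
  · exact (one_div_pos.2 (hρpos k)).le

lemma sum_invPriorityGap {n : ℕ} (ρ : Fin n → ℝ) (i : Fin n) :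
    ∑ k ∈ Finset.Iic i, invPriorityGap ρ k = 1 / ρ i := by
  obtain ⟨m, hm⟩ := i
  induction m with
  | zero =>
    have : Finset.Iic (⟨0, hm⟩ : Fin n) = {⟨0, hm⟩} := by
      ext k
      simp [Fin.le_def, Fin.ext_iff]
    simp [this, invPriorityGap]
  | succ m ih =>
    have : Finset.Iic (⟨m + 1, hm⟩ : Fin n) =
        insert ⟨m + 1, hm⟩ (Finset.Iic ⟨m, by omega⟩) := by
      ext k
      simp only [Finset.mem_Iic, Finset.mem_insert, Fin.le_def, Fin.ext_iff]
      omega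
    rw [this, Finset.sum_insert (by simp [Fin.le_def]), ih]
    simp [invPriorityGap]

/-- The batch of an agent is completed by the deadline of that agent. -/
lemma batch_completion_le {n b : ℕ} (hb : 1 ≤ b) {ρ : Fin n → ℝ} (hρpos : ∀ i, 0 < ρ i)
    (hρ : Antitone ρ) {T : ℝ} (hT : 0 ≤ T) (i : Fin n) :
    (((i : ℕ) / b : ℕ) + 1 : ℝ) * T ≤ timeConstant b ρ T / ρ i := by
  obtain ⟨m, hm⟩ : ∃ m, m = min ((i : ℕ) + 1) b := ⟨_, rfl⟩
  have hm1 : 1 ≤ m := by omega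
  have hm0 : (0 : ℝ) < m := by exact_mod_cast hm1
  have hgap := invPriorityGap_nonneg hρpos hρ
  -- The lower bound serves only to make the denominator positive; the upper bound by `m / ρ i`
  -- gives the estimate.
  have hlow : 1 / ρ i ≤ ∑ k ∈ Finset.Iic i,
      ((min ((i : ℕ) - (k : ℕ) + 1) b : ℕ) : ℝ) * invPriorityGap ρ k := by
    rw [← sum_invPriorityGap]
    refine Finset.sum_le_sum fun k _ => le_mul_of_one_le_left (hgap k) ?_
    exact_mod_cast (by omega : 1 ≤ min ((i : ℕ) - (k : ℕ) + 1) b)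
  have hup : ∑ k ∈ Finset.Iic i,
      ((min ((i : ℕ) - (k : ℕ) + 1) b : ℕ) : ℝ) * invPriorityGap ρ k ≤ m * (1 / ρ i) := by
    rw [← sum_invPriorityGap, Finset.mul_sum]
    refine Finset.sum_le_sum fun k _ => mul_le_mul_of_nonneg_right ?_ (hgap k)
    exact_mod_cast (by omega : min ((i : ℕ) - (k : ℕ) + 1) b ≤ m)
  have hpos := (one_div_pos.2 (hρpos i)).trans_le hlow
  have hC : 2 * ((i : ℝ) + 1) * T / (m * (1 / ρ i)) ≤ timeConstant b ρ T :=
    (div_le_div_of_nonneg_left (by positivity) hpos hup).trans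
      (le_ciSup (f := fun i : Fin n => 2 * ((i : ℝ) + 1) * T / ∑ k ∈ Finset.Iic i,
        ((min ((i : ℕ) - (k : ℕ) + 1) b : ℕ) : ℝ) * invPriorityGap ρ k)
        (Set.finite_range _).bddAbove i)
  -- Here the factor 2 is spent: full batches before `i` contribute at most `i`, since `m ≤ b`, and
  -- its own batch at most `i + 1`.
  have hnat : ((i : ℕ) / b + 1) * m ≤ 2 * ((i : ℕ) + 1) := by
    have h1 : (i : ℕ) / b * m ≤ (i : ℕ) :=
      (Nat.mul_le_mul_left _ (by omega)).trans (Nat.div_mul_le_self (i : ℕ) b)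
    rw [add_mul, one_mul]
    omega
  have hreal : (((i : ℕ) / b : ℕ) + 1 : ℝ) * m ≤ 2 * ((i : ℝ) + 1) := by exact_mod_cast hnat
  rw [le_div_iff₀ (hρpos i)]
  refine le_trans ?_ hC
  have hρi := hρpos i
  rw [le_div_iff₀ (by positivity)]
  calc _ = ((((i : ℕ) / b : ℕ) + 1 : ℝ) * m) * T := by field_simp
    _ ≤ _ := mul_le_mul_of_nonneg_right hreal hT

end EnvOpt

/-! ### Assembly of the policy -/

theorem theorem4
    (n b : ℕ) (hb : 1 ≤ b) (hbn : b < n)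
    -- the environment, the agents, their initial positions and destinations
    (E : Set EnvOpt.Plane) (hE : MeasurableSet E)
    (r : Fin n → ℝ) (hr : ∀ i, 0 < r i)
    (s d : Fin n → EnvOpt.Plane)
    (hSD : Disjoint (EnvOpt.occupied r s) (EnvOpt.occupied r d))
    -- the trajectories for the empty environment and their velocities
    (T : ℝ) (hT : 0 < T) (p v : Fin n → ℝ → EnvOpt.Plane)
    (hp : EnvOpt.IsEmptyEnvironmentPlan E r s d T p)
    (hv : ∀ i, ∀ t ∈ Icc 0 T, HasDerivWithinAt (p i) (v i t) (Icc 0 T) t)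
    (rmax : ℝ) (hrmax : IsGreatest (Set.range r) rmax)
    (vmax : ℝ) (hvmax : IsGreatest {x : ℝ | ∃ i, ∃ t ∈ Icc 0 T, x = ‖v i t‖} vmax)
    -- the initial obstacle region
    (Δ : Set EnvOpt.Plane) (hΔm : MeasurableSet Δ) (hΔfin : volume Δ ≠ ⊤) (hΔne : Δ.Nonempty)
    (hΔ : Δ ⊆ E \ (EnvOpt.occupied r s ∪ EnvOpt.occupied r d))
    (hfree : (E \ (Δ ∪ EnvOpt.occupied r s ∪ EnvOpt.occupied r d)).Nonempty)
    -- the priorities and the capacity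
    (ρ : Fin n → ℝ) (hρpos : ∀ i, 0 < ρ i) (hρ : Antitone ρ)
    (c : ℝ) (hc : 2 * (b : ℝ) * rmax * vmax ≤ c) (hc' : c < 2 * ((b : ℝ) + 1) * rmax * vmax)
    -- the number of sub-tasks into which every trajectory is cut
    (H : ℕ) (hH : 1 ≤ H) :
    ∃ (σ : ℕ → Finset (Fin n)) (q : ℝ → Fin n → EnvOpt.Plane)
      (π : (Fin n → EnvOpt.Plane) → Set EnvOpt.Plane),
      -- at most `b` agents are served in a time slice, every agent is served `H` times
      (∀ k, (σ k).card ≤ b) ∧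
      (∀ i, ∃ K : ℕ, ∀ k, K ≤ k → EnvOpt.servedCount σ i k = H) ∧
      EnvOpt.FollowsSchedule T H p σ q ∧
      -- the obstacle region is controlled online, from the current positions of the agents
      EnvOpt.IsObstacleMotion E Δ c (fun t => π (q t)) ∧
      -- all navigation tasks are carried out without collision, within the stated times
      EnvOpt.IsCollisionFree E r (fun t => π (q t)) q ∧
      (∀ i, q 0 i = s i) ∧
      (∀ i, ∃ Tnav : ℝ, 0 ≤ Tnav ∧ Tnav ≤ EnvOpt.timeConstant b ρ T / ρ i ∧
        ∀ t, Tnav ≤ t → q t i = d i) := by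
  have hT0 := hT.le
  have hs : ∀ i j, i ≠ j → r i + r j ≤ ‖s i - s j‖ := fun i j hij => by
    simpa only [hp.start_eq] using
      hp.nonoverlap i j hij 0 (left_mem_Icc.2 hT0) 0 (left_mem_Icc.2 hT0)
  have hrle : ∀ i, r i ≤ rmax := fun i => hrmax.2 (mem_range_self i)
  have hrmax0 : 0 ≤ rmax := by
    obtain ⟨i, hi⟩ := hrmax.1
    exact hi ▸ (hr i).le
  have hvle : ∀ i, ∀ t ∈ Icc 0 T, ‖v i t‖ ≤ vmax := fun i t ht => hvmax.2 ⟨i, t, ht, rfl⟩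
  have hvmax0 : 0 ≤ vmax := by
    obtain ⟨i, t, -, ht⟩ := hvmax.1
    exact ht ▸ norm_nonneg _
  have hSm := EnvOpt.measurableSet_openBodies r s
  have hΔS : Disjoint Δ (EnvOpt.occupied r s) :=
    Set.disjoint_left.2 fun z hz hzs => (hΔ hz).2 (Or.inl hzs)
  have hS0 : EnvOpt.openBodies r s ⊆ EnvOpt.occupied r s := EnvOpt.openBodies_subset_occupied r s
  have hex : ∀ x : Fin n → EnvOpt.Plane, ∃ a, volume (EnvOpt.sweptRegion Δ
      (EnvOpt.openBodies r s) (EnvOpt.openBodies r x) a) = volume Δ := fun x =>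
    EnvOpt.exists_volume_sweptRegion_eq hΔfin hSm (EnvOpt.isBounded_openBodies r s)
      (hΔS.mono_right hS0) (EnvOpt.volume_openBodies_le hs x)
  -- The line depends on the current positions alone, so the policy is online.
  choose a ha using hex
  have hprog : ∀ (i : Fin n) (t : ℝ), EnvOpt.batchProgress T ((i : ℕ) / b) t ∈ Icc 0 T :=
    fun i t => EnvOpt.batchProgress_mem hT0 _ t
  have hq0 : ∀ i : Fin n, p i (EnvOpt.batchProgress T ((i : ℕ) / b) 0) = s i := fun i => by
    rw [EnvOpt.batchProgress, max_eq_left (by rw [zero_sub, neg_nonpos]; positivity),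
      min_eq_right hT0, hp.start_eq]
  have hsE : EnvOpt.openBodies r s ⊆ E := iUnion_subset fun i =>
    Metric.ball_subset_closedBall.trans
      (hp.start_eq i ▸ hp.mem_env i 0 (left_mem_Icc.2 hT0))
  have hgain : ∀ t₁ t₂, 0 ≤ t₁ → t₁ ≤ t₂ →
      2 * rmax * ∑ i : Fin n, ‖p i (EnvOpt.batchProgress T ((i : ℕ) / b) t₂) -
        p i (EnvOpt.batchProgress T ((i : ℕ) / b) t₁)‖ ≤ c * (t₂ - t₁) := by
    intro t₁ t₂ h0 h
    calc _ ≤ 2 * rmax * ∑ i : Fin n, vmax * (EnvOpt.batchProgress T ((i : ℕ) / b) t₂ -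
          EnvOpt.batchProgress T ((i : ℕ) / b) t₁) := by
          refine mul_le_mul_of_nonneg_left (Finset.sum_le_sum fun i _ => ?_) (by positivity)
          refine (Convex.norm_image_sub_le_of_norm_hasDerivWithin_le (hv i) (hvle i)
            (convex_Icc 0 T) (hprog i t₁) (hprog i t₂)).trans (le_of_eq ?_)
          rw [Real.norm_of_nonneg (sub_nonneg.2 (EnvOpt.batchProgress_mono T _ h))]
      _ ≤ 2 * rmax * (vmax * (b * (t₂ - t₁))) := by
          rw [← Finset.mul_sum]
          gcongr
          exact EnvOpt.sum_batchProgress_sub_le hb hT0 h0 h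
      _ = 2 * b * rmax * vmax * (t₂ - t₁) := by ring
      _ ≤ c * (t₂ - t₁) := mul_le_mul_of_nonneg_right hc (sub_nonneg.2 h)
  refine ⟨EnvOpt.batchSchedule n b H, fun t i => p i (EnvOpt.batchProgress T ((i : ℕ) / b) t),
    fun x => EnvOpt.sweptRegion Δ (EnvOpt.openBodies r s) (EnvOpt.openBodies r x) (a x),
    fun k => EnvOpt.card_filter_div_eq_le n (k / H) hb, fun i => ⟨(i : ℕ) / b * H + H, ?_⟩,
    EnvOpt.followsSchedule_batchSchedule hH hT0 p, ⟨?_, ?_, ?_, ?_, ?_⟩, ⟨?_, ?_, ?_⟩, hq0,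
    fun i => ⟨(((i : ℕ) / b : ℕ) + 1 : ℝ) * T, by positivity,
      EnvOpt.batch_completion_le hb hρpos hρ hT0 i, ?_⟩⟩
  · intro k hk
    rw [EnvOpt.servedCount_batchSchedule hH]
    omega
  -- At time 0 the bodies cover exactly the open starting disks, so the region is `Δ` whatever line
  -- was chosen.
  · simp only [hq0]
    ext z
    constructor
    · rintro ⟨hz | hz, hz'⟩
      · exact hz
      · exact (hz' hz.1).elim
    · exact fun hz => ⟨Or.inl hz, fun h => Set.disjoint_left.1 hΔS hz (hS0 h)⟩
  · exact fun t _ => EnvOpt.measurableSet_sweptRegion hΔm hSm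
      (EnvOpt.measurableSet_openBodies r _) _
  · rintro t - z ⟨hz | hz, -⟩
    · exact (hΔ hz).1
    · exact hsE hz.1
  · exact fun t _ => ha _
  · intro t₁ t₂ h0 h
    refine EnvOpt.volume_symmDiff_sweptRegion_le hΔm hSm (EnvOpt.measurableSet_openBodies r _)
      (EnvOpt.measurableSet_openBodies r _) (by rw [ha]; exact hΔfin) (by rw [ha, ha])
      ((EnvOpt.volume_openBodies_diff_le (fun i => (hr i).le) hrle _ _).trans
        (ENNReal.ofReal_le_ofReal ?_))
      ((EnvOpt.volume_openBodies_diff_le (fun i => (hr i).le) hrle _ _).trans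
        (ENNReal.ofReal_le_ofReal (hgain t₁ t₂ h0 h)))
    simpa only [norm_sub_rev] using hgain t₁ t₂ h0 h
  · exact fun t _ i => hp.mem_env i _ (hprog i t)
  · rintro t - i z ⟨-, hz⟩
    by_contra hlt
    refine hz (mem_iUnion.2 ⟨i, ?_⟩)
    rw [Metric.mem_ball, dist_eq_norm, norm_sub_rev]
    exact not_le.1 hlt
  · exact fun t _ i j hij => hp.nonoverlap i j hij _ (hprog i t) _ (hprog j t)
  · intro t ht
    simp only
    rw [EnvOpt.batchProgress, min_eq_left (le_max_of_le_right (by linarith)), hp.end_eq]
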